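/- Let $\mu\ge 2$ and let $(V,\mathcal B)$ be a Steiner $2$-design $S(2,\mu,v)$, i.e. $|V|=v$, the blocks $B\in\mathcal B$ are $\mu$-subsets of $V$, and any two distinct points lie in exactly one block. Assume that its replication number $r=\frac{v-1}{\mu-1}$ is odd. Let $(V_i,\mathcal B_i)$, $1\le i\le j$, be proper subdesigns of $(V,\mathcal B)$ (that is, $V_i\subsetneq V$, $\mathcal B_i\subsetneq\mathcal B$, and $(V_i,\mathcal B_i)$ is an $S(2,\mu,|V_i|)$) such that the $V_i$ are pairwise disjoint, $\bigcup_{i=1}^j V_i\subsetneq V$, and every replication number $\frac{|V_i|-1}{\mu-1}$ is odd. Let $H$ be any point-by-block incidence matrix over $\mathbb F_2$ of $(V,\mathcal B\setminus\bigcup_i\mathcal B_i)$. An $[[n,k;c]]$ entanglement-assisted quantum error-correcting code (EAQECC) encodes $k$ logical qubits into $n$ physical qubits by a unitary that acts on the logical qubits, the sender's halves of $c$ maximally entangled qubit pairs shared with the receiver, and $n-k-c$ ancilla qubits in state $|0\rangle$. It is a CSS code of the binary matrix $H$ with $n$ columns if its code space (a space of states of the $n$ physical qubits and the receiver's $c$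 qubits) is the joint $+1$ eigenspace of operators $X^{h}\otimes X^{e_h}$ and $Z^{h}\otimes Z^{f_h}$, one of each for every row $h$ of $H$, for suitable $e_h,f_h\in\mathbb F_2^c$. Then $H$ has $$n=\frac{v(v-1)}{\mu(\mu-1)}-\Bigl|\bigcup_{i=1}^j\mathcal B_i\Bigr|$$ columns, $\operatorname{rank}_{\mathbb F_2}(HH^{T})=j+1$, and there exists an $[[n,k;c]]$ EAQECC that is a CSS code of $H$, with $c=j+1$ and $k=n-2\operatorname{rank}_{\mathbb F_2}(H)+j+1$. -/

import Mathlib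

/-! ### Steiner 2-designs, subdesigns and incidence matrices -/

/-- `(P, 𝓑)` is a Steiner 2-design `S(2, μ, v)`: `P` is a set of `v` points, every block is a
`μ`-subset of `P`, and any two distinct points of `P` lie in exactly one common block. -/
structure IsSteinerTwoDesign {V : Type*} (μ v : ℕ) (P : Finset V) (𝓑 : Finset (Finset V)) :
    Prop where
  card_points : P.card = v
  block_subset : ∀ B ∈ 𝓑, B ⊆ P
  block_card : ∀ B ∈ 𝓑, B.card = μ
  existsUnique_block : ∀ x ∈ P, ∀ y ∈ P, x ≠ y → ∃! B, B ∈ 𝓑 ∧ x ∈ B ∧ y ∈ B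

/-- The replication number `r = (v - 1) / (μ - 1)` of an `S(2, μ, v)`. The division is exact
as soon as there is a nonempty design with these parameters and `2 ≤ μ`. -/
def replicationNumber (μ v : ℕ) : ℕ := (v - 1) / (μ - 1)

/-- `(P', 𝓑')` is a proper subdesign of block size `μ` of `(P, 𝓑)`. -/
structure IsProperSubdesign {V : Type*} (μ : ℕ) (P : Finset V) (𝓑 : Finset (Finset V))
    (P' : Finset V) (𝓑' : Finset (Finset V)) : Prop where
  points_ssubset : P' ⊂ P
  blocks_ssubset : 𝓑' ⊂ 𝓑
  isSteiner : IsSteinerTwoDesign μ P'.card P' 𝓑'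

/-- The binary point-by-block incidence matrix of a family of blocks `b`. -/
def incidenceMatrix {V ι : Type*} [DecidableEq V] (b : ι → Finset V) : Matrix V ι (ZMod 2) :=
  Matrix.of fun x i => if x ∈ b i then 1 else 0

/-! ### Qubit registers and Pauli operators -/

/-- The state space `(ℂ²)^{⊗ι}` of a register of qubits indexed by `ι`. A vector is given by its
coordinates in the computational basis `|a⟩`, `a ∈ 𝔽₂^ι`. -/
abbrev Qubits (ι : Type*) : Type _ := EuclideanSpace ℂ (ι → ZMod 2)

/-- The Pauli operator `X^u = ⨂ᵢ X^{uᵢ}`, which maps `|a⟩` to `|a + u⟩`. -/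
def pauliX {ι : Type*} (u : ι → ZMod 2) (φ : Qubits ι) : Qubits ι :=
  WithLp.toLp 2 fun a => φ (a - u)

/-- The Pauli operator `Z^u = ⨂ᵢ Z^{uᵢ}`, which maps `|a⟩` to `(-1)^{u ⬝ a} |a⟩`. -/
def pauliZ {ι : Type*} [Fintype ι] (u : ι → ZMod 2) (φ : Qubits ι) : Qubits ι :=
  WithLp.toLp 2 fun a => (if u ⬝ᵥ a = 0 then 1 else -1) * φ a

/-- `U ⊗ I` acting on the joint register `α ⊕ γ`. -/
noncomputable def tensorId {α β γ : Type*} [Fintype α] [Fintype β] [DecidableEq α] [DecidableEq β]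
    (U : Qubits α ≃ₗᵢ[ℂ] Qubits β) (φ : Qubits (α ⊕ γ)) : Qubits (β ⊕ γ) :=
  WithLp.toLp 2 fun p =>
    U (WithLp.toLp 2 fun a => φ (Sum.elim a (p ∘ Sum.inr))) (p ∘ Sum.inl)

/-! ### Entanglement-assisted quantum codes -/

/-- The sender's and the receiver's qubits before encoding: the state
`|ψ⟩ ⊗ |Φ⟩^{⊗c} ⊗ |0⟩^{⊗s}`, where `|Φ⟩ = (|0⟩|0⟩ + |1⟩|1⟩) / √2` is a maximally entangled pair.
The sender holds the `k` logical qubits, the first halves of the `c` pairs, and the `s` ancillas;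
the receiver holds the second halves of the pairs (the last summand of the register). -/
noncomputable def initialState {k c s : ℕ} (ψ : Qubits (Fin k)) :
    Qubits ((Fin k ⊕ (Fin c ⊕ Fin s)) ⊕ Fin c) :=
  WithLp.toLp 2 fun p =>
    if (∀ i : Fin c, p (.inl (.inr (.inl i))) = p (.inr i)) ∧
        (∀ l : Fin s, p (.inl (.inr (.inr l))) = 0)
    then ((Real.sqrt 2 : ℂ) ^ c)⁻¹ * ψ fun i => p (.inl (.inl i))
    else 0

/-- An `[[n, k; c]]` entanglement-assisted quantum code: `k` logical qubits are encoded into `n`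
physical qubits with the help of `c` copies of a maximally entangled pair shared with the
receiver, by a unitary that acts on the sender's qubits only (logical qubits, halves of the
`c` pairs, and `s` ancillas in the state `|0⟩`). Unitarity forces `k + c + s = n`. -/
structure EAQECC (n k c : ℕ) where
  s : ℕ
  encoder : Qubits (Fin k ⊕ (Fin c ⊕ Fin s)) ≃ₗᵢ[ℂ] Qubits (Fin n)

/-- The encoding of a logical state as a joint state of the `n` physical qubits and the
receiver's `c` qubits. -/
noncomputable def EAQECC.encode {n k c : ℕ} (Q : EAQECC n k c) (ψ : Qubits (Fin k)) :
    Qubits (Fin n ⊕ Fin c) :=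
  tensorId Q.encoder (initialState ψ)

/-- The code space: all encoded states. -/
def EAQECC.codeSpace {n k c : ℕ} (Q : EAQECC n k c) : Set (Qubits (Fin n ⊕ Fin c)) :=
  Set.range Q.encode

/-- `Q` is obtained by the entanglement-assisted CSS construction from the binary parity-check
matrix `H`: each row `h` of `H` gives an `X`-check `X^h` and a `Z`-check `Z^h` on the `n` physical
qubits, these checks are extended by operators `X^e`, `Z^f` on the receiver's `c` qubits, and the
code space is the set of all states fixed by all extended checks. (As the code space is nonzero,
the extended checks automatically commute.) -/
def EAQECC.IsCSSCodeOf {n k c : ℕ} (Q : EAQECC n k c) {m : Type*} (H : Matrix m (Fin n) (ZMod 2)) :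
    Prop :=
  ∃ E F : Matrix m (Fin c) (ZMod 2),
    Q.codeSpace = {φ | ∀ i : m,
      pauliX (Sum.elim (H i) (E i)) φ = φ ∧ pauliZ (Sum.elim (H i) (F i)) φ = φ}

/-! ### Counting in Steiner 2-designs -/

namespace IsSteinerTwoDesign

variable {V : Type*} [DecidableEq V] {μ v : ℕ} {P : Finset V} {𝓑 : Finset (Finset V)}

/-! An entry of `H * H.transpose` counts, mod 2, the remaining blocks through two points. In the
full design every count is odd (`r` on the diagonal, 1 off it), and each subdesign removes the
all-one matrix on `P' i`. Hence `H * H.transpose = E * E.transpose`, where the columns of `E` are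
the all-one vector and the indicators of the `P' i` (`incidence_gram_eq`). As the `P' i` are
nonempty, disjoint and not covering, `E` has a left inverse `L`, so the rank is `j + 1`.

For the code, `G = [H | E]` satisfies `G * G.transpose = 0` in characteristic 2 and has the rank of
`H`. Its CSS code on `n + c` qubits is spanned by the uniform superpositions over the cosets of the
row space `R` in `ker G`, labelled by `x ∈ 𝔽₂^k`. Let `S x y` be the part of coset `x` with receiver
bits `y`. By `L * E = 1` these sets are nonempty, disjoint and of equal size, so any unitary sending
`|x, y, 0⟩` to the uniform state on `S x y` encodes the code while acting on the sender's side only.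
-/

theorem card_blocks_through_mul (h : IsSteinerTwoDesign μ v P 𝓑) {x : V} (hx : x ∈ P) :
    {B ∈ 𝓑 | x ∈ B}.card * (μ - 1) = v - 1 := by
  have key : P.erase x = {B ∈ 𝓑 | x ∈ B}.biUnion fun B => B.erase x := by
    ext y
    simp only [Finset.mem_erase, Finset.mem_biUnion, Finset.mem_filter]
    constructor
    · rintro ⟨hne, hy⟩
      obtain ⟨B, ⟨hB, hxB, hyB⟩, -⟩ := h.existsUnique_block x hx y hy hne.symm
      exact ⟨B, ⟨hB, hxB⟩, hne, hyB⟩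
    · rintro ⟨B, ⟨hB, -⟩, hne, hyB⟩
      exact ⟨hne, h.block_subset B hB hyB⟩
  have hcard := congrArg Finset.card key
  rw [Finset.card_erase_of_mem hx, h.card_points, Finset.card_biUnion] at hcard
  · rw [hcard, Finset.sum_const_nat (m := μ - 1)]
    intro B hB
    rw [Finset.mem_filter] at hB
    rw [Finset.card_erase_of_mem hB.2, h.block_card B hB.1]
  · intro B hB C hC hBC
    rw [Finset.mem_coe, Finset.mem_filter] at hB hC
    refine Finset.disjoint_left.mpr fun y hyB hyC => ?_
    rw [Finset.mem_erase] at hyB hyC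
    exact hBC ((h.existsUnique_block x hx y (h.block_subset B hB.1 hyB.2) hyB.1.symm).unique
      ⟨hB.1, hB.2, hyB.2⟩ ⟨hC.1, hC.2, hyC.2⟩)

theorem card_blocks_through (h : IsSteinerTwoDesign μ v P 𝓑) (hμ : 2 ≤ μ) {x : V} (hx : x ∈ P) :
    {B ∈ 𝓑 | x ∈ B}.card = replicationNumber μ v := by
  rw [replicationNumber, ← h.card_blocks_through_mul hx, Nat.mul_div_cancel _ (by omega)]

theorem card_blocks_mul (h : IsSteinerTwoDesign μ v P 𝓑) :
    𝓑.card * (μ * (μ - 1)) = v * (v - 1) := by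
  have hcount := Finset.sum_card_bipartiteAbove_eq_sum_card_bipartiteBelow
    (fun (x : V) (B : Finset V) => x ∈ B) (s := P) (t := 𝓑)
  have hright : ∑ B ∈ 𝓑, (Finset.bipartiteBelow (fun (x : V) (B : Finset V) => x ∈ B) P B).card
      = 𝓑.card * μ := by
    refine Finset.sum_const_nat fun B hB => ?_
    rw [← h.block_card B hB, Finset.bipartiteBelow, Finset.filter_mem_eq_inter,
      Finset.inter_eq_right.mpr (h.block_subset B hB)]
  rw [← mul_assoc, ← hright, ← hcount, Finset.sum_mul]
  rw [Finset.sum_const_nat (m := v - 1), h.card_points]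
  exact fun x hx => h.card_blocks_through_mul hx

end IsSteinerTwoDesign

/-! ### Self-orthogonal matrices -/

theorem span_row_le_ker_mulVecLin {m ι F : Type*} [Fintype ι] [Field F] {G : Matrix m ι F}
    (hG : G * G.transpose = 0) :
    Submodule.span F (Set.range G.row) ≤ LinearMap.ker G.mulVecLin := by
  rw [Submodule.span_le]
  rintro _ ⟨i, rfl⟩
  rw [SetLike.mem_coe, LinearMap.mem_ker]
  ext i'
  simpa [Matrix.mul_apply, Matrix.mulVec, dotProduct, Matrix.row] using
    congrFun (congrFun hG i') i

/-- `f` supplies the logical labels: self-orthogonality gives `R ≤ K`, and `K ⧸ R` has dimension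
`card ι - 2 * G.rank = k`. An isomorphism of `K ⧸ R` with `F^k` is extended arbitrarily from `K` to
all vectors. -/
theorem exists_linearMap_ker_mod_rowSpace {m ι : Type*} [Fintype m] [Fintype ι]
    {F : Type*} [Field F] {k : ℕ} (G : Matrix m ι F) (hG : G * G.transpose = 0)
    (hk : k + 2 * G.rank = Fintype.card ι) :
    ∃ f : (ι → F) →ₗ[F] (Fin k → F), (∀ x, ∃ w, G.mulVec w = 0 ∧ f w = x) ∧
      ∀ w, G.mulVec w = 0 → (f w = 0 ↔ w ∈ Submodule.span F (Set.range G.row)) := by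
  set R := Submodule.span F (Set.range G.row) with hR
  set K := LinearMap.ker G.mulVecLin with hK
  have hRK : R ≤ K := span_row_le_ker_mulVecLin hG
  have hKdim : G.rank + Module.finrank F K = _ :=
    LinearMap.finrank_range_add_finrank_ker G.mulVecLin
  have hRdim : G.rank = Module.finrank F R := G.rank_eq_finrank_span_row
  have hQ := Submodule.finrank_quotient_add_finrank (R.comap K.subtype)
  rw [(Submodule.comapSubtypeEquivOfLe hRK).finrank_eq] at hQ
  rw [Module.finrank_fintype_fun_eq_card] at hKdim
  have hfr : Module.finrank F (K ⧸ R.comap K.subtype) = Module.finrank F (Fin k → F) := by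
    rw [Module.finrank_fintype_fun_eq_card, Fintype.card_fin]
    omega
  let g := LinearEquiv.ofFinrankEq _ _ hfr
  obtain ⟨f, hf⟩ := LinearMap.exists_extend (g.toLinearMap ∘ₗ (R.comap K.subtype).mkQ)
  have hfK : ∀ w : K, f w = g ((R.comap K.subtype).mkQ w) := fun w => LinearMap.congr_fun hf w
  refine ⟨f, fun x => ?_, fun w hw => ?_⟩
  · obtain ⟨w, hw⟩ := (R.comap K.subtype).mkQ_surjective (g.symm x)
    exact ⟨w, w.2, by rw [hfK, hw, g.apply_symm_apply]⟩
  · have hwK : w ∈ K := hw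
    rw [hfK ⟨w, hwK⟩, g.map_eq_zero_iff, Submodule.mkQ_apply, Submodule.Quotient.mk_eq_zero]
    rfl

theorem fromCols_mul_transpose_eq_zero {m n c F : Type*} [Fintype n] [Fintype c] [Field F]
    [CharP F 2] {H : Matrix m n F} {E : Matrix m c F}
    (hHE : H * H.transpose = E * E.transpose) :
    Matrix.fromCols H E * (Matrix.fromCols H E).transpose = 0 := by
  rw [Matrix.transpose_fromCols, Matrix.fromCols_mul_fromRows, hHE]
  ext i i'
  exact CharTwo.add_self_eq_zero _

section FactoredGram

variable {m n c F : Type*} [Fintype m] [Fintype n] [Fintype c] [DecidableEq c] [Field F]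
  {H : Matrix m n F} {E : Matrix m c F} {L : Matrix c m F}

theorem rank_gram_eq_card (hHE : H * H.transpose = E * E.transpose) (hL : L * E = 1) :
    (H * H.transpose).rank = Fintype.card c := by
  rw [hHE]
  refine le_antisymm ((Matrix.rank_mul_le_left _ _).trans (Matrix.rank_le_card_width _)) ?_
  have h1 : L * (E * E.transpose) * L.transpose = 1 := by
    rw [← Matrix.mul_assoc, hL, Matrix.one_mul, ← Matrix.transpose_mul, hL, Matrix.transpose_one]
  rw [← Matrix.rank_one (R := F) (n := c), ← h1]
  exact (Matrix.rank_mul_le_left _ _).trans (Matrix.rank_mul_le_right _ _)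

/-- Multiplying the Gram identity by `L.transpose` gives `E = H * (H.transpose * L.transpose)`, so
appending `E` does not enlarge the column space. -/
theorem rank_fromCols_eq (hHE : H * H.transpose = E * E.transpose) (hL : L * E = 1) :
    (Matrix.fromCols H E).rank = H.rank := by
  classical
  have hE : E = H * (H.transpose * L.transpose) := by
    rw [← Matrix.mul_assoc, hHE, Matrix.mul_assoc, ← Matrix.transpose_mul, hL,
      Matrix.transpose_one, Matrix.mul_one]
  apply le_antisymm
  · have : Matrix.fromCols H E = H * Matrix.fromCols 1 (H.transpose * L.transpose) := by
      rw [Matrix.mul_fromCols, Matrix.mul_one, ← hE]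
    rw [this]
    exact Matrix.rank_mul_le_left _ _
  · have : H = Matrix.fromCols H E * Matrix.fromRows (1 : Matrix n n F) (0 : Matrix c n F) := by
      rw [Matrix.fromCols_mul_fromRows, Matrix.mul_one, Matrix.mul_zero, add_zero]
    conv_lhs => rw [this]
    exact Matrix.rank_mul_le_left _ _

/-- Guarantees that the natural-number subtraction defining `k` in the main theorem does not
truncate. -/
theorem two_mul_rank_le [CharP F 2] (hHE : H * H.transpose = E * E.transpose) (hL : L * E = 1) :
    2 * H.rank ≤ Fintype.card n + Fintype.card c := by
  rw [two_mul, ← rank_fromCols_eq hHE hL, ← Fintype.card_sum]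
  conv_lhs => rw [← Matrix.rank_transpose (Matrix.fromCols H E)]
  have := Matrix.rank_add_rank_le_card_of_mul_eq_zero (fromCols_mul_transpose_eq_zero hHE)
  rwa [Matrix.rank_transpose] at this ⊢

end FactoredGram

/-! ### The encoder -/

/-- The uniform superposition of the basis states `|a⟩` with `a ∈ S`. -/
noncomputable def uniformState {ι : Type*} [Fintype ι] (S : Finset (ι → ZMod 2)) : Qubits ι :=
  WithLp.toLp 2 fun a => open Classical in if a ∈ S then ((Real.sqrt S.card : ℂ))⁻¹ else 0

theorem inner_uniformState_self {ι : Type*} [Fintype ι] [DecidableEq ι]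
    {S : Finset (ι → ZMod 2)} (hS : S.Nonempty) :
    inner ℂ (uniformState S) (uniformState S) = 1 := by
  classical
  have hpos : (0 : ℝ) < S.card := by exact_mod_cast hS.card_pos
  have hsq : (Real.sqrt S.card : ℂ) * (Real.sqrt S.card : ℂ) = S.card := by
    rw [← Complex.ofReal_mul, Real.mul_self_sqrt hpos.le, Complex.ofReal_natCast]
  simp only [uniformState, PiLp.inner_apply, RCLike.inner_apply, apply_ite (starRingEnd ℂ), map_inv₀,
    Complex.conj_ofReal, map_zero, mul_ite, ite_mul, zero_mul, mul_zero]
  simp only [← ite_and, and_self, Finset.sum_ite_mem, Finset.univ_inter, Finset.sum_const,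
    nsmul_eq_mul]
  rw [← mul_inv, hsq]
  exact mul_inv_cancel₀ (by exact_mod_cast hpos.ne')

theorem inner_uniformState_of_disjoint {ι : Type*} [Fintype ι] [DecidableEq ι]
    {S T : Finset (ι → ZMod 2)} (hST : Disjoint S T) :
    inner ℂ (uniformState S) (uniformState T) = 0 := by
  classical
  rw [PiLp.inner_apply]
  refine Finset.sum_eq_zero fun a _ => ?_
  by_cases ha : a ∈ S
  · simp [uniformState, ha, Finset.disjoint_left.mp hST ha]
  · simp [uniformState, ha]

/-- Any family of nonempty, pairwise disjoint sets labelled by the logical qubits and the halves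
of the maximally entangled pairs is realized by an encoder. -/
theorem exists_encoder_uniformState {n k c s : ℕ} (hn : k + c + s = n)
    (S : (Fin k → ZMod 2) → (Fin c → ZMod 2) → Finset (Fin n → ZMod 2))
    (hne : ∀ x y, (S x y).Nonempty)
    (hdisj : ∀ x y x' y' a, a ∈ S x y → a ∈ S x' y' → x = x' ∧ y = y') :
    ∃ b : OrthonormalBasis (Fin k ⊕ (Fin c ⊕ Fin s) → ZMod 2) ℂ (Qubits (Fin n)),
      ∀ p, (∀ l : Fin s, p (.inr (.inr l)) = 0) →
        b p = uniformState (S (fun i => p (.inl i)) fun i => p (.inr (.inl i))) := by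
  -- Only labels with zero ancillas are prescribed; disjoint supports make them orthonormal, and `k
  -- + c + s = n` lets them extend to a full basis.
  refine Orthonormal.exists_orthonormalBasis_extension_of_card_eq (𝕜 := ℂ)
    (s := {p | ∀ l : Fin s, p (.inr (.inr l)) = 0})
    (v := fun p : Fin k ⊕ (Fin c ⊕ Fin s) → ZMod 2 =>
      uniformState (S (fun i => p (.inl i)) fun i => p (.inr (.inl i)))) ?_ ?_
  · simp only [finrank_euclideanSpace, Fintype.card_fun, Fintype.card_sum, Fintype.card_fin]
    rw [← hn, add_assoc]
  · classical
    rw [orthonormal_iff_ite]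
    rintro ⟨p, hp⟩ ⟨q, hq⟩
    split_ifs with hpq
    · obtain rfl : p = q := congrArg Subtype.val hpq
      exact inner_uniformState_self (hne _ _)
    · refine inner_uniformState_of_disjoint (Finset.disjoint_left.mpr fun a ha ha' => hpq ?_)
      obtain ⟨h1, h2⟩ := hdisj _ _ _ _ a ha ha'
      apply Subtype.ext
      ext (i | i | i)
      · exact congrFun h1 i
      · exact congrFun h2 i
      · exact (hp i).trans (hq i).symm

theorem exists_EAQECC_encode_eq {n k c s : ℕ} (hn : k + c + s = n)
    (S : (Fin k → ZMod 2) → (Fin c → ZMod 2) → Finset (Fin n → ZMod 2))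
    (hne : ∀ x y, (S x y).Nonempty)
    (hdisj : ∀ x y x' y' a, a ∈ S x y → a ∈ S x' y' → x = x' ∧ y = y') :
    ∃ Q : EAQECC n k c, ∀ ψ q,
      (∀ x, q ∘ Sum.inl ∈ S x (q ∘ Sum.inr) →
        Q.encode ψ q = ((Real.sqrt 2 : ℂ) ^ c)⁻¹ * ψ x *
          ((Real.sqrt (S x (q ∘ Sum.inr)).card : ℂ))⁻¹) ∧
      ((∀ x, q ∘ Sum.inl ∉ S x (q ∘ Sum.inr)) → Q.encode ψ q = 0) := by
  classical
  obtain ⟨b, hb⟩ := exists_encoder_uniformState hn S hne hdisj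
  let Q : EAQECC n k c := ⟨s, (EuclideanSpace.basisFun _ ℂ).equiv b (Equiv.refl _)⟩
  have hQ : ∀ ψ q, Q.encode ψ q = ∑ p : Fin k ⊕ (Fin c ⊕ Fin s) → ZMod 2,
      initialState ψ (Sum.elim p (q ∘ Sum.inr)) * b p (q ∘ Sum.inl) := by
    intro ψ q
    simp only [EAQECC.encode, tensorId, Q, OrthonormalBasis.equiv_apply]
    simp [Finset.sum_apply]
  have hzero : ∀ (ψ : Qubits (Fin k)) (q : Fin n ⊕ Fin c → ZMod 2)
      (p : Fin k ⊕ (Fin c ⊕ Fin s) → ZMod 2),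
      initialState ψ (Sum.elim p (q ∘ Sum.inr)) * b p (q ∘ Sum.inl) ≠ 0 →
      (fun i => p (.inr (.inl i))) = q ∘ Sum.inr ∧ (∀ l, p (.inr (.inr l)) = 0) ∧
        q ∘ Sum.inl ∈ S (fun i => p (.inl i)) (q ∘ Sum.inr) := by
    intro ψ q p hp
    have h1 := left_ne_zero_of_mul hp
    have h2 := right_ne_zero_of_mul hp
    obtain ⟨h3, h4⟩ : (∀ i : Fin c, p (.inr (.inl i)) = (q ∘ Sum.inr) i) ∧
        ∀ l : Fin s, p (.inr (.inr l)) = 0 := by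
      by_contra hcond
      exact h1 (if_neg hcond)
    have h5 : (fun i => p (.inr (.inl i))) = q ∘ Sum.inr := funext h3
    refine ⟨h5, h4, ?_⟩
    rw [hb p h4, h5] at h2
    by_contra hmem
    simp [uniformState, hmem] at h2
  refine ⟨Q, fun ψ q => ⟨fun x hx => ?_, fun hx => ?_⟩⟩
  -- Equal halves, zero ancillas and disjointness of the `S x y` leave a single nonzero term.
  · rw [hQ, Finset.sum_eq_single (Sum.elim x (Sum.elim (q ∘ Sum.inr) 0))]
    · rw [hb _ (by simp)]
      have hx' : (fun i => q (Sum.inl i)) ∈ S (fun i => x i) (fun i => q (Sum.inr i)) := hx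
      simp [initialState, uniformState, Function.comp_def, hx']
    · intro p _ hp
      by_contra hne0
      obtain ⟨h1, h2, h3⟩ := hzero ψ q p hne0
      apply hp
      ext (i | i | i)
      · exact congrFun (hdisj _ _ _ _ _ h3 hx).1 i
      · exact congrFun h1 i
      · exact h2 i
    · simp
  · rw [hQ]
    refine Finset.sum_eq_zero fun p _ => ?_
    by_contra hne0
    exact hx _ (hzero ψ q p hne0).2.2

/-! ### The entanglement-assisted CSS construction -/

/-- The `X`-checks force amplitudes to be constant on cosets of the row space; the `Z`-checks, by
the next lemma, confine the support to `ker G`. -/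
theorem eq_of_forall_pauliX_eq {m ι : Type*} {G : Matrix m ι (ZMod 2)} {φ : Qubits ι}
    (hφ : ∀ i, pauliX (G i) φ = φ) {r : ι → ZMod 2}
    (hr : r ∈ Submodule.span (ZMod 2) (Set.range G.row)) (q : ι → ZMod 2) :
    φ (q - r) = φ q := by
  induction hr using Submodule.span_induction generalizing q with
  | mem r hr =>
    obtain ⟨i, rfl⟩ := hr
    exact congrArg (fun χ : Qubits ι => χ q) (hφ i)
  | zero => rw [sub_zero]
  | add r r' _ _ h h' => rw [← sub_sub, h', h]
  | smul a r _ h =>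
    have ha : ∀ a : ZMod 2, a = 0 ∨ a = 1 := by decide
    rcases ha a with rfl | rfl
    · rw [zero_smul, sub_zero]
    · rw [one_smul, h]

theorem pauliZ_eq_self_iff {ι : Type*} [Fintype ι] {u : ι → ZMod 2} {φ : Qubits ι} :
    pauliZ u φ = φ ↔ ∀ q, u ⬝ᵥ q ≠ 0 → φ q = 0 := by
  constructor
  · intro h q hq
    have h1 : (if u ⬝ᵥ q = 0 then 1 else -1) * φ q = φ q :=
      congrArg (fun χ : Qubits ι => χ q) h
    rw [if_neg hq, neg_one_mul] at h1
    exact self_eq_neg.mp h1.symm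
  · intro h
    ext q
    change (if u ⬝ᵥ q = 0 then 1 else -1) * φ q = φ q
    split_ifs with hq
    · rw [one_mul]
    · rw [h q hq, mul_zero]

theorem exists_EAQECC_isCSSCodeOf {m : Type*} [Fintype m] {n k c : ℕ}
    {H : Matrix m (Fin n) (ZMod 2)} {E : Matrix m (Fin c) (ZMod 2)}
    {L : Matrix (Fin c) m (ZMod 2)} (hHE : H * H.transpose = E * E.transpose)
    (hL : L * E = 1) (hk : k + 2 * H.rank = n + c) :
    ∃ Q : EAQECC n k c, Q.IsCSSCodeOf H := by
  classical
  set G := Matrix.fromCols H E with hGdef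
  have hG : G * G.transpose = 0 := fromCols_mul_transpose_eq_zero hHE
  have hGmul : ∀ q, G.mulVec q = H.mulVec (q ∘ Sum.inl) + E.mulVec (q ∘ Sum.inr) :=
    Matrix.fromCols_mulVec _ _
  -- The left inverse of `E` makes the sender's bits determine the receiver's bits within `ker G`.
  have hGE : ∀ a y y', G.mulVec (Sum.elim a y) = 0 → G.mulVec (Sum.elim a y') = 0 → y = y' := by
    intro a y y' h h'
    rw [hGmul, Sum.elim_comp_inl, Sum.elim_comp_inr] at h h'
    have h1 : E.mulVec y = E.mulVec y' := add_left_cancel (h.trans h'.symm)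
    simpa [hL] using congrArg L.mulVec h1
  have hrank : G.rank = H.rank := rank_fromCols_eq hHE hL
  obtain ⟨f, hfsurj, hfker⟩ := exists_linearMap_ker_mod_rowSpace (k := k) G hG
    (by rw [hrank, hk, Fintype.card_sum, Fintype.card_fin, Fintype.card_fin])
  have hrow : ∀ r ∈ Submodule.span (ZMod 2) (Set.range G.row), G.mulVec r = 0 ∧ f r = 0 := by
    intro r hr
    have h1 : G.mulVec r = 0 := span_row_le_ker_mulVecLin hG hr
    exact ⟨h1, (hfker r h1).mpr hr⟩
  let S : (Fin k → ZMod 2) → (Fin c → ZMod 2) → Finset (Fin n → ZMod 2) := fun x y =>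
    {a | G.mulVec (Sum.elim a y) = 0 ∧ f (Sum.elim a y) = x}
  have hS : ∀ x y a, a ∈ S x y ↔ G.mulVec (Sum.elim a y) = 0 ∧ f (Sum.elim a y) = x := by
    simp [S]
  have hne : ∀ x y, (S x y).Nonempty := by
    intro x y
    obtain ⟨w, hw, hfw⟩ := hfsurj x
    -- Adding the row combination `u G` keeps `w` in its coset, and `L * E = 1` makes its receiver
    -- part become `y`.
    let u := Matrix.vecMul (y - w ∘ Sum.inr) L
    have hu : Matrix.vecMul u G ∈ Submodule.span (ZMod 2) (Set.range G.row) := by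
      rw [Matrix.vecMul_eq_sum]
      exact Submodule.sum_mem _ fun i _ => Submodule.smul_mem _ _ (Submodule.subset_span ⟨i, rfl⟩)
    have huE : Matrix.vecMul u G ∘ Sum.inr = y - w ∘ Sum.inr := by
      rw [hGdef, Matrix.vecMul_fromCols, Sum.elim_comp_inr, Matrix.vecMul_vecMul, hL,
        Matrix.vecMul_one]
    have hsplit : Sum.elim ((w + Matrix.vecMul u G) ∘ Sum.inl) y = w + Matrix.vecMul u G := by
      ext (i | i)
      · rfl
      · have := congrFun huE i
        simp only [Function.comp_apply, Pi.sub_apply] at this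
        simp [this]
    refine ⟨(w + Matrix.vecMul u G) ∘ Sum.inl, (hS _ _ _).mpr ?_⟩
    rw [hsplit, Matrix.mulVec_add, map_add, hw, hfw, (hrow _ hu).1, (hrow _ hu).2]
    exact ⟨add_zero _, add_zero _⟩
  have hdisj : ∀ x y x' y' a, a ∈ S x y → a ∈ S x' y' → x = x' ∧ y = y' := by
    intro x y x' y' a h h'
    rw [hS] at h h'
    obtain rfl := hGE _ _ _ h.1 h'.1
    exact ⟨h.2.symm.trans h'.2, rfl⟩
  -- Translation by an element of `S x y` carries it onto `S 0 0`, so all encoded amplitudes share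
  -- one normalization `M`.
  have hcard : ∀ x y, (S x y).card = (S 0 0).card := by
    intro x y
    obtain ⟨a₀, ha₀⟩ := hne x y
    rw [hS] at ha₀
    have hsub : ∀ a : Fin n → ZMod 2,
        Sum.elim (a - a₀) (0 : Fin c → ZMod 2) = Sum.elim a y - Sum.elim a₀ y := by
      intro a
      ext (i | i) <;> simp
    refine Finset.card_bijective (fun a => a - a₀) (Equiv.subRight a₀).bijective fun a => ?_
    rw [hS, hS, hsub, Matrix.mulVec_sub, map_sub, ha₀.1, ha₀.2, sub_zero, sub_eq_zero]
  -- From `c = rank (H Hᵀ) ≤ rank H` and `k + 2 * rank H = n + c`; hence the ancilla count `n - (k +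
  -- c)` is exact.
  have hcn : k + c ≤ n := by
    have h1 := rank_gram_eq_card hHE hL
    have h2 := Matrix.rank_mul_le_left H H.transpose
    rw [Fintype.card_fin] at h1
    omega
  obtain ⟨Q, hQ⟩ := exists_EAQECC_encode_eq (s := n - (k + c)) (by omega) S hne hdisj
  set M : ℂ := ((Real.sqrt 2 : ℂ) ^ c)⁻¹ * ((Real.sqrt (S 0 0).card : ℂ))⁻¹ with hM
  have hM0 : M ≠ 0 := by
    have h1 : (Real.sqrt 2 : ℂ) ≠ 0 := by
      exact_mod_cast (Real.sqrt_pos.mpr (by norm_num : (0 : ℝ) < 2)).ne'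
    have h2 : (Real.sqrt (S 0 0).card : ℂ) ≠ 0 := by
      exact_mod_cast (Real.sqrt_pos.mpr (by exact_mod_cast (hne 0 0).card_pos)).ne'
    exact mul_ne_zero (inv_ne_zero (pow_ne_zero _ h1)) (inv_ne_zero h2)
  have hS' : ∀ x q, q ∘ Sum.inl ∈ S x (q ∘ Sum.inr) ↔ G.mulVec q = 0 ∧ f q = x := by
    intro x q
    rw [hS, Sum.elim_comp_inl_inr]
  have henc : ∀ ψ q, Q.encode ψ q = if G.mulVec q = 0 then M * ψ (f q) else 0 := by
    intro ψ q
    split_ifs with hq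
    · rw [(hQ ψ q).1 (f q) ((hS' _ _).mpr ⟨hq, rfl⟩), hcard, hM]
      ring
    · exact (hQ ψ q).2 fun x hx => hq ((hS' _ _).mp hx).1
  refine ⟨Q, E, E, Set.ext fun φ => ?_⟩
  rw [Set.mem_ofPred_eq]
  change _ ↔ ∀ i, pauliX (G i) φ = φ ∧ pauliZ (G i) φ = φ
  simp only [pauliZ_eq_self_iff]
  constructor
  · rintro ⟨ψ, rfl⟩ i
    constructor
    · ext q
      change Q.encode ψ (q - G i) = Q.encode ψ q
      have hi := hrow (G i) (Submodule.subset_span ⟨i, rfl⟩)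
      rw [henc, henc, Matrix.mulVec_sub, map_sub, hi.1, hi.2, sub_zero, sub_zero]
    · intro q hq
      rw [henc, if_neg]
      exact fun h => hq (congrFun h i)
  · intro h
    choose w hw hfw using hfsurj
    -- The logical amplitude at `x` is read off at a representative `w x` of coset `x`.
    refine ⟨WithLp.toLp 2 fun x => M⁻¹ * φ (w x), ?_⟩
    ext q
    rw [henc]
    split_ifs with hq
    · change M * (M⁻¹ * φ (w (f q))) = φ q
      rw [mul_inv_cancel_left₀ hM0]
      have hmem : q - w (f q) ∈ Submodule.span (ZMod 2) (Set.range G.row) := by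
        rw [← hfker _ (by rw [Matrix.mulVec_sub, hq, hw, sub_zero]), map_sub, hfw, sub_self]
      rw [← eq_of_forall_pauliX_eq (fun i => (h i).1) hmem q, sub_sub_cancel]
    · obtain ⟨i, hi⟩ := Function.ne_iff.mp hq
      exact ((h i).2 q hi).symm

/-! ### Removing the blocks of disjoint subdesigns -/

/-- The columns are the all-one vector and the indicator vectors of the sets `P i`. -/
def indicatorMatrix {V : Type*} [DecidableEq V] {j : ℕ} (P : Fin j → Finset V) :
    Matrix V (Fin (j + 1)) (ZMod 2) :=
  Matrix.of fun x => Fin.cons 1 fun i => if x ∈ P i then 1 else 0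

theorem exists_mul_indicatorMatrix_eq_one {V : Type*} [Fintype V] [DecidableEq V] {j : ℕ}
    {P : Fin j → Finset V} (hne : ∀ i, (P i).Nonempty)
    (hdisj : ∀ i i', i ≠ i' → Disjoint (P i) (P i')) {x₀ : V} (hx₀ : ∀ i, x₀ ∉ P i) :
    ∃ L : Matrix (Fin (j + 1)) V (ZMod 2), L * indicatorMatrix P = 1 := by
  choose x hx using hne
  have hxP : ∀ i i', x i ∈ P i' ↔ i = i' := fun i i' =>
    ⟨fun h => by_contra fun hii => Finset.disjoint_left.mp (hdisj i i' hii) (hx i) h,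
      fun h => h ▸ hx i⟩
  -- Row 0 evaluates at the uncovered point `x₀`; the others evaluate at `x i ∈ P i` minus at `x₀`,
  -- which kills the all-one column.
  let L : Fin (j + 1) → V → ZMod 2 :=
    Fin.cons (Pi.single x₀ 1) fun i => Pi.single (x i) 1 - Pi.single x₀ 1
  refine ⟨Matrix.of L, ?_⟩
  ext a b
  change L a ⬝ᵥ (fun y => (Fin.cons 1 fun i => if y ∈ P i then 1 else 0 : Fin (j + 1) → ZMod 2) b)
    = (1 : Matrix _ _ _) a b
  refine Fin.cases ?_ (fun a => ?_) a <;> refine Fin.cases ?_ (fun b => ?_) b <;>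
    simp [L, sub_dotProduct, hx₀, hxP, Matrix.one_apply, (Fin.succ_ne_zero _).symm]

theorem indicatorMatrix_mul_transpose_apply {V : Type*} [DecidableEq V] {j : ℕ}
    (P : Fin j → Finset V) (x y : V) :
    (indicatorMatrix P * (indicatorMatrix P).transpose) x y =
      1 + ∑ i, if x ∈ P i ∧ y ∈ P i then 1 else 0 := by
  simp [Matrix.mul_apply, indicatorMatrix, Fin.sum_univ_succ, ← ite_and, and_comm]

theorem incidenceMatrix_mul_transpose_apply {V ι : Type*} [DecidableEq V] [Fintype ι]
    (𝓒 : Finset (Finset V)) (e : ι ≃ {B : Finset V // B ∈ 𝓒}) (x y : V) :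
    (incidenceMatrix (fun i => (e i : Finset V)) *
      (incidenceMatrix fun i => (e i : Finset V)).transpose) x y =
      ({B ∈ 𝓒 | x ∈ B ∧ y ∈ B}.card : ZMod 2) := by
  have h1 : ∑ i, (if x ∈ (e i : Finset V) ∧ y ∈ (e i : Finset V) then (1 : ZMod 2) else 0) =
      ∑ B : {B : Finset V // B ∈ 𝓒}, if x ∈ (B : Finset V) ∧ y ∈ (B : Finset V) then 1 else 0 :=
    e.sum_comp fun B => if x ∈ (B : Finset V) ∧ y ∈ (B : Finset V) then 1 else 0
  rw [← Finset.sum_boole, ← Finset.sum_coe_sort, ← h1]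
  simp [Matrix.mul_apply, incidenceMatrix, ← ite_and, and_comm]

theorem IsSteinerTwoDesign.incidence_gram_eq {V ι : Type*} [Fintype V] [DecidableEq V]
    [Fintype ι] {μ v j : ℕ} (hμ : 2 ≤ μ) {𝓑 : Finset (Finset V)}
    (hD : IsSteinerTwoDesign μ v Finset.univ 𝓑) (hr : Odd (replicationNumber μ v))
    {P' : Fin j → Finset V} {𝓑' : Fin j → Finset (Finset V)}
    (hsub : ∀ i, IsProperSubdesign μ Finset.univ 𝓑 (P' i) (𝓑' i))
    (hdisj : ∀ i i', i ≠ i' → Disjoint (P' i) (P' i'))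
    (hr' : ∀ i, Odd (replicationNumber μ (P' i).card))
    (e : ι ≃ {B : Finset V // B ∈ 𝓑 \ Finset.univ.biUnion 𝓑'}) :
    incidenceMatrix (fun i => (e i : Finset V)) *
      (incidenceMatrix fun i => (e i : Finset V)).transpose =
      indicatorMatrix P' * (indicatorMatrix P').transpose := by
  have hall : ∀ x y, ({B ∈ 𝓑 | x ∈ B ∧ y ∈ B}.card : ZMod 2) = 1 := by
    intro x y
    rcases eq_or_ne x y with rfl | hxy
    · simp only [and_self]
      rw [hD.card_blocks_through hμ (Finset.mem_univ x)]
      exact hr.natCast_zmod_two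
    · obtain ⟨B, hB, huniq⟩ := hD.existsUnique_block x (Finset.mem_univ x) y (Finset.mem_univ y) hxy
      have : {B ∈ 𝓑 | x ∈ B ∧ y ∈ B} = {B} := by
        ext C
        rw [Finset.mem_filter, Finset.mem_singleton]
        exact ⟨huniq C, fun h => h ▸ hB⟩
      rw [this, Finset.card_singleton, Nat.cast_one]
  have hpart : ∀ i x y, ({B ∈ 𝓑' i | x ∈ B ∧ y ∈ B}.card : ZMod 2) =
      if x ∈ P' i ∧ y ∈ P' i then 1 else 0 := by
    intro i x y
    have hS := (hsub i).isSteiner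
    split_ifs with hxy
    · rcases eq_or_ne x y with rfl | hne
      · simp only [and_self]
        rw [hS.card_blocks_through hμ hxy.1]
        exact (hr' i).natCast_zmod_two
      · obtain ⟨B, hB, huniq⟩ := hS.existsUnique_block x hxy.1 y hxy.2 hne
        have : {B ∈ 𝓑' i | x ∈ B ∧ y ∈ B} = {B} := by
          ext C
          rw [Finset.mem_filter, Finset.mem_singleton]
          exact ⟨huniq C, fun h => h ▸ hB⟩
        rw [this, Finset.card_singleton, Nat.cast_one]
    · rw [Finset.filter_false_of_mem, Finset.card_empty, Nat.cast_zero]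
      exact fun B hB h => hxy ⟨hS.block_subset B hB h.1, hS.block_subset B hB h.2⟩
  ext x y
  rw [incidenceMatrix_mul_transpose_apply, indicatorMatrix_mul_transpose_apply]
  have hsplit := Finset.card_sdiff_add_card_eq_card (s := {B ∈ Finset.univ.biUnion 𝓑' | x ∈ B ∧ y ∈ B})
    (t := {B ∈ 𝓑 | x ∈ B ∧ y ∈ B}) (Finset.filter_subset_filter _
      (Finset.biUnion_subset.mpr fun i _ => (hsub i).blocks_ssubset.subset))
  have hdiff : {B ∈ 𝓑 | x ∈ B ∧ y ∈ B} \ {B ∈ Finset.univ.biUnion 𝓑' | x ∈ B ∧ y ∈ B} =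
      {B ∈ 𝓑 \ Finset.univ.biUnion 𝓑' | x ∈ B ∧ y ∈ B} := by
    ext B
    simp only [Finset.mem_sdiff, Finset.mem_filter]
    tauto
  have hbi : {B ∈ Finset.univ.biUnion 𝓑' | x ∈ B ∧ y ∈ B}.card =
      ∑ i, {B ∈ 𝓑' i | x ∈ B ∧ y ∈ B}.card := by
    -- A block through `x` in two subdesigns would put `x` in two disjoint point sets.
    rw [Finset.filter_biUnion, Finset.card_biUnion]
    intro i _ i' _ hii
    refine Finset.disjoint_left.mpr fun B hB hB' => ?_
    rw [Finset.mem_filter] at hB hB'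
    exact Finset.disjoint_left.mp (hdisj i i' hii)
      ((hsub i).isSteiner.block_subset B hB.1 hB.2.1)
      ((hsub i').isSteiner.block_subset B hB'.1 hB'.2.1)
  rw [hdiff, hbi] at hsplit
  have hcast := congrArg (Nat.cast : ℕ → ZMod 2) hsplit
  rw [Nat.cast_add, Nat.cast_sum, hall] at hcast
  simp only [hpart] at hcast
  exact (CharTwo.add_eq_iff_eq_add.mp hcast)

theorem mainTheorem7 {V : Type*} [Fintype V] [DecidableEq V] (μ v j : ℕ) (hμ : 2 ≤ μ)
    (𝓑 : Finset (Finset V)) (hD : IsSteinerTwoDesign μ v Finset.univ 𝓑)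
    (hr : Odd (replicationNumber μ v))
    (P' : Fin j → Finset V) (𝓑' : Fin j → Finset (Finset V))
    (hsub : ∀ i, IsProperSubdesign μ Finset.univ 𝓑 (P' i) (𝓑' i))
    (hdisj : ∀ i i', i ≠ i' → Disjoint (P' i) (P' i'))
    (hunion : Finset.univ.biUnion P' ⊂ Finset.univ)
    (hr' : ∀ i, Odd (replicationNumber μ (P' i).card)) :
    ∃ n k : ℕ,
      n = (𝓑 \ Finset.univ.biUnion 𝓑').card ∧
      (n : ℚ) = (v : ℚ) * ((v : ℚ) - 1) / ((μ : ℚ) * ((μ : ℚ) - 1))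
        - ((Finset.univ.biUnion 𝓑').card : ℚ) ∧
      ∀ (e : Fin n ≃ {B : Finset V // B ∈ 𝓑 \ Finset.univ.biUnion 𝓑'})
        (H : Matrix V (Fin n) (ZMod 2)), H = incidenceMatrix (fun i => (e i : Finset V)) →
        (H * H.transpose).rank = j + 1 ∧
        (k : ℤ) = (n : ℤ) - 2 * (H.rank : ℤ) + ((j : ℤ) + 1) ∧
        ∃ Q : EAQECC n k (j + 1), Q.IsCSSCodeOf H := by
  -- An empty point set would have replication number 0 by truncated subtraction, which is even.
  have hPne : ∀ i, (P' i).Nonempty := by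
    intro i
    rw [Finset.nonempty_iff_ne_empty]
    intro h
    have := hr' i
    rw [h, Finset.card_empty, replicationNumber, Nat.zero_sub, Nat.zero_div] at this
    exact Nat.not_odd_zero this
  obtain ⟨x₀, -, hx₀⟩ := Finset.exists_of_ssubset hunion
  obtain ⟨L, hL⟩ := exists_mul_indicatorMatrix_eq_one hPne hdisj (x₀ := x₀)
    fun i hi => hx₀ (Finset.mem_biUnion.mpr ⟨i, Finset.mem_univ i, hi⟩)
  -- `k` must be fixed before `e` and `H`, so the rank is taken with columns indexed by the blocks
  -- themselves; relabelling columns preserves it.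
  let b₀ : {B : Finset V // B ∈ 𝓑 \ Finset.univ.biUnion 𝓑'} → Finset V := fun B => B
  have hle : 2 * (incidenceMatrix b₀).rank ≤ (𝓑 \ Finset.univ.biUnion 𝓑').card + (j + 1) := by
    have := two_mul_rank_le
      (hD.incidence_gram_eq hμ hr hsub hdisj hr' (Equiv.refl _)) hL
    rwa [Fintype.card_coe, Fintype.card_fin] at this
  refine ⟨_, (𝓑 \ Finset.univ.biUnion 𝓑').card + (j + 1) - 2 * (incidenceMatrix b₀).rank,
    rfl, ?_, ?_⟩
  · have hsubset : Finset.univ.biUnion 𝓑' ⊆ 𝓑 :=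
      Finset.biUnion_subset.mpr fun i _ => (hsub i).blocks_ssubset.subset
    have hv : 1 ≤ v := by
      rw [← hD.card_points]
      exact Finset.card_pos.mpr ⟨x₀, Finset.mem_univ x₀⟩
    have hcount : (𝓑.card : ℚ) * (μ * (μ - 1)) = v * (v - 1) := by
      have := congrArg (Nat.cast : ℕ → ℚ) hD.card_blocks_mul
      push_cast [hv, (by omega : 1 ≤ μ)] at this
      exact this
    have hμ' : (2 : ℚ) ≤ μ := by exact_mod_cast hμ
    have hne : (μ : ℚ) * (μ - 1) ≠ 0 := mul_ne_zero (by linarith) (by linarith)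
    rw [Finset.card_sdiff_of_subset hsubset, Nat.cast_sub (Finset.card_le_card hsubset), ← hcount,
      mul_div_cancel_right₀ _ hne]
  · rintro e H rfl
    have hgram := hD.incidence_gram_eq hμ hr hsub hdisj hr' e
    have hrank : (incidenceMatrix fun i => (e i : Finset V)).rank = (incidenceMatrix b₀).rank :=
      (incidenceMatrix b₀).rank_submatrix (Equiv.refl V) e
    refine ⟨?_, ?_, ?_⟩
    · rw [rank_gram_eq_card hgram hL, Fintype.card_fin]
    · rw [hrank]
      omega
    · exact exists_EAQECC_isCSSCodeOf hgram hL (by rw [hrank]; omega)
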